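/- Let $d\ge 1$. For a Lebesgue measurable set $E\subset\mathbb{R}^d$ let $$P(E)=\sup\Big\{-\int_E \operatorname{div}\xi\,dx \;:\; \xi\in C_c^1(\mathbb{R}^d;\mathbb{R}^d),\ \sup|\xi|\le 1\Big\}\in[0,\infty]$$ denote its perimeter, and say that $E$ has finite perimeter if $P(E)<\infty$. For Lebesgue measurable sets $E,F\subset\mathbb{R}^d$ of finite volume let $$W_1(\chi_E,\chi_F)=\inf_\gamma \iint |x-y|\,d\gamma(x,y)\in[0,\infty],$$ where the infimum runs over all measures $\gamma$ on $\mathbb{R}^d\times\mathbb{R}^d$ with marginals $\chi_E(x)\,dx$ and $\chi_F(y)\,dy$; in particular $W_1(\chi_E,\chi_F)=+\infty$ if $|E|\neq|F|$. There is a constant $C<\infty$, depending only on $d$, such that for all sets $E,F\subset\mathbb{R}^d$ of finite perimeter with $\int_{E\cup F}|x|\,dx<\infty$ (which forces $|E|,|F|<\infty$), $$|E\triangle F|\le C\,\sqrt{P(E)+P(F)}\,\sqrt{W_1(\chi_E,\chi_F)}$$ (with the convention $0\cdot\infty=0$ on the right-hand side). -/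

import Mathlib

open MeasureTheory

open scoped ENNReal NNReal symmDiff

noncomputable section

/-- The divergence `∑ i, ∂ᵢ ξᵢ` of a vector field on `ℝ^d`. -/
def divergence {d : ℕ} (ξ : EuclideanSpace ℝ (Fin d) → EuclideanSpace ℝ (Fin d))
    (x : EuclideanSpace ℝ (Fin d)) : ℝ :=
  ∑ i : Fin d, (fderiv ℝ ξ x (EuclideanSpace.single i 1)) i

/-- The perimeter `P(E) = sup { -∫_E div ξ dx : ξ ∈ C_c^1(ℝ^d; ℝ^d), sup |ξ| ≤ 1 }` in `[0, ∞]`.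
Since `ξ = 0` is admissible the supremum is nonnegative, so truncating negative values by
`ENNReal.ofReal` does not change it. -/
def perimeter {d : ℕ} (E : Set (EuclideanSpace ℝ (Fin d))) : ℝ≥0∞ :=
  ⨆ (ξ : EuclideanSpace ℝ (Fin d) → EuclideanSpace ℝ (Fin d))
    (_ : ContDiff ℝ 1 ξ) (_ : HasCompactSupport ξ) (_ : ∀ x, ‖ξ x‖ ≤ 1),
    ENNReal.ofReal (-∫ x in E, divergence ξ x)

/-- `E` has finite perimeter: it is Lebesgue measurable and `P(E) < ∞`. -/
def HasFinitePerimeter {d : ℕ} (E : Set (EuclideanSpace ℝ (Fin d))) : Prop :=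
  NullMeasurableSet E volume ∧ perimeter E < ∞

/-- `γ` is a transport plan between `μ` and `ν`: its marginals are `μ` and `ν`. -/
def IsTransportPlan {X : Type*} [MeasurableSpace X] (μ ν : Measure X)
    (γ : Measure (X × X)) : Prop :=
  γ.map Prod.fst = μ ∧ γ.map Prod.snd = ν

/-- The `1`-Wasserstein distance `inf ∬ |x - y| dγ(x, y)` over all transport plans `γ` between
`μ` and `ν`. It is `∞` if there is none, that is, if finite measures `μ`, `ν` differ in mass. -/
def wassersteinOne {X : Type*} [MeasurableSpace X] [PseudoEMetricSpace X]
    (μ ν : Measure X) : ℝ≥0∞ :=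
  ⨅ (γ : Measure (X × X)) (_ : IsTransportPlan μ ν γ), ∫⁻ p, edist p.1 p.2 ∂γ

end

/-! By duality, `|E ∆ F|` is the supremum of `∫_E η - ∫_F η` over `C_c^1` functions with `|η| ≤ 1`
(`volume_real_symmDiff_le_of_forall_integral_sub_le`). Replace `η` by its average `η_r` at scale
`r`. Translating by `h` lowers `∫_E η` by at most `|h| P(E)`, so the replacement costs at most `r
(P(E) + P(F))` (`setIntegral_sub_average_le_perimeter`). Since `|η| ≤ 1`, `η_r` is `L / r`-Lipschitz
with `L` depending only on `d` (`abs_average_sub_average_le`), so `∫_E η_r - ∫_F η_r ≤ (L / r) W₁`.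
Hence `|E ∆ F| ≤ r (P(E) + P(F)) + (L / r) W₁`, and `r = √(W₁ / (P(E) + P(F)))` gives the claim with
`C = 1 + L`.

When `W₁ = ∞` only the case `P(E) = P(F) = 0` has content: both sets are then null
(`volume_eq_zero_of_perimeter_eq_zero`). -/

theorem volume_lt_top_of_lintegral_enorm_lt_top {d : ℕ} {S : Set (EuclideanSpace ℝ (Fin d))}
    (h : ∫⁻ x in S, ‖x‖ₑ < ∞) : volume S < ∞ := by
  have h1 := mul_meas_ge_le_lintegral (μ := volume.restrict S)
    (f := fun x : EuclideanSpace ℝ (Fin d) => ‖x‖ₑ) measurable_enorm 1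
  rw [one_mul] at h1
  have hcover : (Set.univ : Set (EuclideanSpace ℝ (Fin d))) ⊆
      {x | 1 ≤ ‖x‖ₑ} ∪ Metric.ball 0 1 := by
    intro x _
    by_cases hx : 1 ≤ ‖x‖ₑ
    · exact Or.inl hx
    · right
      rw [not_le, ← ofReal_norm, ← ENNReal.ofReal_one,
        ENNReal.ofReal_lt_ofReal_iff one_pos] at hx
      simpa using hx
  calc volume S = volume.restrict S Set.univ := by simp
    _ ≤ volume.restrict S {x | 1 ≤ ‖x‖ₑ} + volume.restrict S (Metric.ball 0 1) :=
        (measure_mono hcover).trans (measure_union_le _ _)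
    _ ≤ (∫⁻ x in S, ‖x‖ₑ) + volume (Metric.ball (0 : EuclideanSpace ℝ (Fin d)) 1) :=
        add_le_add h1 (Measure.restrict_apply_le _ _)
    _ < ∞ := ENNReal.add_lt_top.2 ⟨h, measure_ball_lt_top⟩

/-! ### Perimeter controls translations. -/

theorem divergence_smul_const {d : ℕ} {η : EuclideanSpace ℝ (Fin d) → ℝ}
    {x : EuclideanSpace ℝ (Fin d)} (hη : DifferentiableAt ℝ η x) (u : EuclideanSpace ℝ (Fin d)) :
    divergence (fun y => η y • u) x = fderiv ℝ η x u := by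
  unfold divergence
  rw [fderiv_smul_const hη]
  have hu : u = ∑ i, u i • EuclideanSpace.single i (1 : ℝ) := by
    have := (EuclideanSpace.basisFun (Fin d) ℝ).sum_repr u
    simpa using this.symm
  conv_rhs => rw [hu]
  simp [map_sum, mul_comm]

/-- The admissible field is `η v / |v|`, whose divergence is `∂_v η / |v|`. -/
theorem neg_integral_fderiv_le_perimeter {d : ℕ} {E : Set (EuclideanSpace ℝ (Fin d))}
    (hE : perimeter E < ∞) {η : EuclideanSpace ℝ (Fin d) → ℝ} (hη : ContDiff ℝ 1 η)
    (hc : HasCompactSupport η) (hb : ∀ x, ‖η x‖ ≤ 1) (v : EuclideanSpace ℝ (Fin d)) :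
    -∫ x in E, fderiv ℝ η x v ≤ ‖v‖ * (perimeter E).toReal := by
  rcases eq_or_ne v 0 with rfl | hv
  · simp
  have hv' : 0 < ‖v‖ := norm_pos_iff.2 hv
  have key : ENNReal.ofReal (-∫ x in E, divergence (fun y => η y • (‖v‖⁻¹ • v)) x)
      ≤ perimeter E := by
    unfold perimeter
    refine le_iSup_of_le (fun y => η y • (‖v‖⁻¹ • v)) ?_
    refine le_iSup_of_le (hη.smul contDiff_const) ?_
    refine le_iSup_of_le hc.smul_right ?_
    refine le_iSup_of_le (fun x => ?_) le_rfl
    rw [norm_smul, norm_smul, norm_inv, norm_norm, inv_mul_cancel₀ hv'.ne', mul_one]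
    exact hb x
  have hdiv : ∀ x, divergence (fun y => η y • (‖v‖⁻¹ • v)) x = ‖v‖⁻¹ * fderiv ℝ η x v := by
    intro x
    rw [divergence_smul_const (hη.differentiable one_ne_zero x)]
    simp
  simp_rw [hdiv] at key
  rw [integral_const_mul] at key
  have := (ENNReal.ofReal_le_iff_le_toReal hE.ne).1 key
  rw [← mul_neg, inv_mul_le_iff₀ hv'] at this
  exact this

/-- Translates of `η` are again admissible, so `t ↦ ∫_E η(x + t h)` has derivative at least `-|h|
P(E)`; the mean value inequality on `[0, 1]` concludes. -/
theorem setIntegral_sub_translate_le_perimeter {d : ℕ} {E : Set (EuclideanSpace ℝ (Fin d))}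
    (hvol : volume E < ∞)
    (hE : perimeter E < ∞) {η : EuclideanSpace ℝ (Fin d) → ℝ} (hη : ContDiff ℝ 1 η)
    (hc : HasCompactSupport η) (hb : ∀ x, ‖η x‖ ≤ 1) (h : EuclideanSpace ℝ (Fin d)) :
    (∫ x in E, η x) - ∫ x in E, η (x + h) ≤ ‖h‖ * (perimeter E).toReal := by
  have hfin : IsFiniteMeasure (volume.restrict E) := ⟨by simpa using hvol⟩
  have hcont := hη.continuous_fderiv one_ne_zero
  obtain ⟨M, hM⟩ := (hc.fderiv ℝ).exists_bound_of_continuous hcont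
  have hder : ∀ t : ℝ, HasDerivAt (fun t : ℝ => ∫ x in E, η (x + t • h))
      (∫ x in E, fderiv ℝ η (x + t • h) h) t := by
    intro t
    refine (hasDerivAt_integral_of_dominated_loc_of_deriv_le (μ := volume.restrict E) (𝕜 := ℝ)
      (F := fun t x => η (x + t • h)) (F' := fun t x => fderiv ℝ η (x + t • h) h)
      (bound := fun _ => M * ‖h‖) (s := Set.univ) Filter.univ_mem ?_ ?_ ?_ ?_ ?_ ?_).2
    · exact Filter.Eventually.of_forall fun s =>
        (hη.continuous.comp (by fun_prop)).aestronglyMeasurable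
    · refine Integrable.of_bound (C := 1)
        (hη.continuous.comp (by fun_prop)).aestronglyMeasurable (ae_of_all _ fun x => hb _)
    · exact ((hcont.comp (by fun_prop : Continuous fun x => x + t • h)).clm_apply
        continuous_const).aestronglyMeasurable
    · exact ae_of_all _ fun x s _ =>
        (ContinuousLinearMap.le_opNorm _ _).trans (by gcongr; exact hM _)
    · exact integrable_const _
    · refine ae_of_all _ fun x s _ => ?_
      have h1 : HasDerivAt (fun t : ℝ => x + t • h) h s := by
        simpa using ((hasDerivAt_id s).smul_const h).const_add x
      exact (hη.differentiable one_ne_zero _).hasFDerivAt.comp_hasDerivAt s h1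
  have hbound : ∀ t : ℝ, -(‖h‖ * (perimeter E).toReal) ≤
      deriv (fun t : ℝ => ∫ x in E, η (x + t • h)) t := by
    intro t
    rw [(hder t).deriv]
    have h2 := neg_integral_fderiv_le_perimeter hE
      (η := fun x => η (x + t • h)) (hη.comp (contDiff_id.add contDiff_const))
      (hc.comp_homeomorph (Homeomorph.addRight (t • h))) (fun x => hb _) h
    simp_rw [fderiv_comp_add_right] at h2
    linarith
  have := mul_sub_le_image_sub_of_le_deriv (fun t => (hder t).differentiableAt) hbound
    (zero_le_one' ℝ)
  simp only [zero_smul, add_zero, one_smul] at this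
  linarith

/-! ### Smooth test functions detect the symmetric difference. -/

theorem exists_contDiff_integral_abs_sub_indicator_le {d : ℕ}
    {S : Set (EuclideanSpace ℝ (Fin d))} (hS : NullMeasurableSet S) (hvol : volume S < ∞)
    {ε : ℝ} (hε : 0 < ε) :
    ∃ f : EuclideanSpace ℝ (Fin d) → ℝ, ContDiff ℝ 1 f ∧ HasCompactSupport f ∧
      (∀ x, 0 ≤ f x) ∧ (∀ x, f x ≤ 1) ∧ ∫ x, |f x - S.indicator 1 x| ≤ ε := by
  obtain ⟨T, hTS, hT, hae⟩ := hS.exists_measurable_subset_ae_eq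
  have hTvol : volume T < ∞ := (measure_mono hTS).trans_lt hvol
  have hδ : ENNReal.ofReal (ε / 2) ≠ 0 := by simpa using hε
  obtain ⟨K, hKT, hK, hTK⟩ := hT.exists_isCompact_sdiff_lt hTvol.ne hδ
  -- `U` surrounds `K` but need not contain `T`: with `f = 1` on `K` and `f = 0` off `U`, the error
  -- lives on `U \ K` and `T \ K`, each of volume at most `ε / 2`. Cutting `U` by a ball makes the
  -- support of `f` compact.
  obtain ⟨U, hKU, hU, hUK⟩ := hK.exists_isOpen_lt_add (μ := volume) hδ
  obtain ⟨R, hR⟩ := hK.isBounded.subset_ball 0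
  obtain ⟨f, hf, hrange, hsupp, hone⟩ := exists_contMDiff_support_eq_eq_one_iff
    (n := 1) (modelWithCornersSelf ℝ (EuclideanSpace ℝ (Fin d)))
    (hU.inter (Metric.isOpen_ball (x := 0) (ε := R))) hK.isClosed (Set.subset_inter hKU hR)
  have h0 : ∀ x, 0 ≤ f x := fun x => (hrange ⟨x, rfl⟩).1
  have h1 : ∀ x, f x ≤ 1 := fun x => (hrange ⟨x, rfl⟩).2
  have hfc : ContDiff ℝ 1 f := by exact_mod_cast hf.contDiff
  refine ⟨f, hfc, ?_, h0, h1, ?_⟩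
  · refine HasCompactSupport.of_support_subset_isCompact (isCompact_closedBall 0 R) ?_
    rw [hsupp]
    exact Set.inter_subset_right.trans Metric.ball_subset_closedBall
  have hKvol : volume K < ∞ := hK.measure_lt_top
  have hUvol : volume U < ∞ := hUK.trans (ENNReal.add_lt_top.2 ⟨hKvol, ENNReal.ofReal_lt_top⟩)
  have hUKm : MeasurableSet (U \ K) := hU.measurableSet.diff hK.measurableSet
  have hTKm : MeasurableSet (T \ K) := hT.diff hK.measurableSet
  have hUK' : volume.real (U \ K) ≤ ε / 2 := by
    rw [measureReal_sdiff hKU hK.measurableSet hUvol.ne]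
    have := ENNReal.toReal_mono (by finiteness) hUK.le
    rw [ENNReal.toReal_add hKvol.ne ENNReal.ofReal_ne_top,
      ENNReal.toReal_ofReal (by positivity)] at this
    simp only [Measure.real]
    linarith
  have hTK' : volume.real (T \ K) ≤ ε / 2 := by
    have := ENNReal.toReal_mono (by finiteness) hTK.le
    rwa [ENNReal.toReal_ofReal (by positivity)] at this
  have hint1 : Integrable ((U \ K).indicator (1 : EuclideanSpace ℝ (Fin d) → ℝ)) :=
    (integrable_indicator_iff hUKm).2 (integrableOn_const
      ((measure_mono Set.sdiff_subset).trans_lt hUvol).ne)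
  have hint2 : Integrable ((T \ K).indicator (1 : EuclideanSpace ℝ (Fin d) → ℝ)) :=
    (integrable_indicator_iff hTKm).2 (integrableOn_const
      ((measure_mono Set.sdiff_subset).trans_lt hTvol).ne)
  calc ∫ x, |f x - S.indicator 1 x|
      ≤ ∫ x, ((U \ K).indicator (1 : EuclideanSpace ℝ (Fin d) → ℝ) x
          + (T \ K).indicator (1 : EuclideanSpace ℝ (Fin d) → ℝ) x) := by
        refine integral_mono_of_nonneg (ae_of_all _ fun x => abs_nonneg _)
          (hint1.add hint2) ?_
        filter_upwards [indicator_ae_eq_of_ae_eq_set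
          (f := (1 : EuclideanSpace ℝ (Fin d) → ℝ)) hae] with x hx
        rw [← hx]
        have hfU : x ∉ U → f x = 0 := fun hxU => by
          by_contra h
          exact hxU ((hsupp.subset h : _ ∧ _).1)
        have hfK : x ∈ K → f x = 1 := (hone x).1
        have := h0 x
        have := h1 x
        by_cases hxK : x ∈ K
        · simp [hfK hxK, hKT hxK, hxK]
        · by_cases hxU : x ∈ U <;> by_cases hxT : x ∈ T <;>
            simp [hxK, hxU, hxT, hfU, abs_le] <;> constructor <;> linarith
    _ = volume.real (U \ K) + volume.real (T \ K) := by
        rw [integral_add hint1 hint2, integral_indicator_one hUKm, integral_indicator_one hTKm]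
    _ ≤ ε := by linarith

/-- The ideal test function is `χ_{E \ F} - χ_{F \ E}`; it is approximated in `L¹` by `f - g`, with
`f, g` valued in `[0, 1]` so that `|f - g| ≤ 1`. -/
theorem volume_real_symmDiff_le_of_forall_integral_sub_le {d : ℕ}
    {E F : Set (EuclideanSpace ℝ (Fin d))} (hE : NullMeasurableSet E) (hF : NullMeasurableSet F)
    (hEv : volume E < ∞) (hFv : volume F < ∞) {M : ℝ}
    (hM : ∀ η : EuclideanSpace ℝ (Fin d) → ℝ, ContDiff ℝ 1 η → HasCompactSupport η →
      (∀ x, ‖η x‖ ≤ 1) → (∫ x in E, η x) - ∫ x in F, η x ≤ M) :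
    volume.real (E ∆ F) ≤ M := by
  refine le_of_forall_pos_le_add fun ε hε => ?_
  have hA := hE.diff hF
  have hB := hF.diff hE
  have hAv : volume (E \ F) < ∞ := (measure_mono Set.sdiff_subset).trans_lt hEv
  have hBv : volume (F \ E) < ∞ := (measure_mono Set.sdiff_subset).trans_lt hFv
  obtain ⟨f, hf, hfc, hf0, hf1, hfi⟩ :=
    exists_contDiff_integral_abs_sub_indicator_le hA hAv (half_pos hε)
  obtain ⟨g, hg, hgc, hg0, hg1, hgi⟩ :=
    exists_contDiff_integral_abs_sub_indicator_le hB hBv (half_pos hε)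
  have hfI : Integrable f := hf.continuous.integrable_of_hasCompactSupport hfc
  have hgI : Integrable g := hg.continuous.integrable_of_hasCompactSupport hgc
  have hAI : Integrable ((E \ F).indicator (1 : EuclideanSpace ℝ (Fin d) → ℝ)) :=
    (integrableOn_const hAv.ne).integrable_indicator₀ hA
  have hBI : Integrable ((F \ E).indicator (1 : EuclideanSpace ℝ (Fin d) → ℝ)) :=
    (integrableOn_const hBv.ne).integrable_indicator₀ hB
  have hηE : Integrable (E.indicator (fun x => f x - g x)) := (hfI.sub hgI).indicator₀ hE
  have hηF : Integrable (F.indicator (fun x => f x - g x)) := (hfI.sub hgI).indicator₀ hF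
  have h1 := hM (fun x => f x - g x) (hf.sub hg) (hfc.sub hgc) (fun x => by
    rw [Real.norm_eq_abs, abs_le]
    constructor <;> linarith [hf0 x, hf1 x, hg0 x, hg1 x])
  have hAint : ∫ x, (E \ F).indicator (1 : EuclideanSpace ℝ (Fin d) → ℝ) x
      = volume.real (E \ F) := by
    rw [integral_indicator₀ hA]; simp
  have hBint : ∫ x, (F \ E).indicator (1 : EuclideanSpace ℝ (Fin d) → ℝ) x
      = volume.real (F \ E) := by
    rw [integral_indicator₀ hB]; simp
  have hsd : volume.real (E ∆ F) = volume.real (E \ F) + volume.real (F \ E) := by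
    rw [Set.symmDiff_def]
    exact measureReal_union₀ hB disjoint_sdiff_sdiff.aedisjoint hAv.ne hBv.ne
  have hfA : Integrable (fun x => |f x - (E \ F).indicator 1 x|) := (hfI.sub hAI).abs
  have hgB : Integrable (fun x => |g x - (F \ E).indicator 1 x|) := (hgI.sub hBI).abs
  have hle : (∫ x, (E \ F).indicator (1 : EuclideanSpace ℝ (Fin d) → ℝ) x)
        + (∫ x, (F \ E).indicator (1 : EuclideanSpace ℝ (Fin d) → ℝ) x)
      ≤ ((∫ x, E.indicator (fun x => f x - g x) x) - ∫ x, F.indicator (fun x => f x - g x) x)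
        + ((∫ x, |f x - (E \ F).indicator 1 x|) + ∫ x, |g x - (F \ E).indicator 1 x|) := by
    have hEF : Integrable (fun x => E.indicator (fun x => f x - g x) x
        - F.indicator (fun x => f x - g x) x) := hηE.sub hηF
    have hfg : Integrable (fun x => |f x - (E \ F).indicator 1 x|
        + |g x - (F \ E).indicator 1 x|) := hfA.add hgB
    rw [← integral_add hAI hBI, ← integral_sub hηE hηF, ← integral_add hfA hgB,
      ← integral_add hEF hfg]
    refine integral_mono (hAI.add hBI) (hEF.add hfg) fun x => ?_
    have := neg_abs_le (f x - 1)
    have := neg_abs_le (g x - 1)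
    have := le_abs_self (f x)
    have := le_abs_self (g x)
    have := abs_nonneg (f x)
    have := abs_nonneg (g x)
    by_cases hxE : x ∈ E <;> by_cases hxF : x ∈ F <;> simp [hxE, hxF] <;> linarith
  rw [hAint, hBint, integral_indicator₀ hE, integral_indicator₀ hF] at hle
  rw [hsd]
  linarith

/-! ### Averaging at scale `r`: error and Lipschitz constant. -/

theorem exists_unit_mass_lipschitz_kernel (d : ℕ) :
    ∃ (k : EuclideanSpace ℝ (Fin d) → ℝ) (K : ℝ≥0), Continuous k ∧ HasCompactSupport k ∧
      (∀ x, 0 ≤ k x) ∧ (∀ x, 1 ≤ ‖x‖ → k x = 0) ∧ ∫ x, k x = 1 ∧ LipschitzWith K k := by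
  let b : ContDiffBump (0 : EuclideanSpace ℝ (Fin d)) := ⟨1 / 2, 1, by norm_num, by norm_num⟩
  obtain ⟨K, hK⟩ := (b.contDiff_normed (μ := volume) (n := 1)).lipschitzWith_of_hasCompactSupport
    b.hasCompactSupport_normed one_ne_zero
  refine ⟨b.normed volume, K, b.continuous_normed, b.hasCompactSupport_normed,
    b.nonneg_normed, fun x hx => ?_, b.integral_normed, hK⟩
  by_contra h
  have : x ∈ Function.support (b.normed volume) := h
  rw [b.support_normed_eq] at this
  exact absurd (mem_ball_zero_iff.1 this) (not_lt.2 hx)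

/-- After Fubini this is the translation bound for `h = r z`, averaged against `k(z) dz`; `k`
vanishes unless `|z| < 1`. -/
theorem setIntegral_sub_average_le_perimeter {d : ℕ} {E : Set (EuclideanSpace ℝ (Fin d))}
    (hvol : volume E < ∞) (hE : perimeter E < ∞) {k : EuclideanSpace ℝ (Fin d) → ℝ}
    (hk : Continuous k) (hkc : HasCompactSupport k) (hk0 : ∀ x, 0 ≤ k x)
    (hksupp : ∀ x, 1 ≤ ‖x‖ → k x = 0) (hk1 : ∫ x, k x = 1)
    {η : EuclideanSpace ℝ (Fin d) → ℝ} (hη : ContDiff ℝ 1 η)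
    (hc : HasCompactSupport η) (hb : ∀ x, ‖η x‖ ≤ 1) {r : ℝ} (hr : 0 ≤ r) :
    (∫ x in E, η x) - ∫ x in E, ∫ z, k z * η (x + r • z) ≤ r * (perimeter E).toReal := by
  have hfin : IsFiniteMeasure (volume.restrict E) := ⟨by simpa using hvol⟩
  have hkI : Integrable k := hk.integrable_of_hasCompactSupport hkc
  have hηc := hη.continuous
  have hprod : Integrable (Function.uncurry fun x z => k z * η (x + r • z))
      ((volume.restrict E).prod volume) := by
    refine Integrable.mul_bdd (c := 1) (hkI.comp_snd (volume.restrict E)) ?_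
      (ae_of_all _ fun p => hb _)
    exact (hηc.comp (by fun_prop)).aestronglyMeasurable
  have hinner : Integrable fun z => ∫ x in E, k z * η (x + r • z) := hprod.integral_prod_right
  rw [integral_integral_swap hprod]
  have h1 : ∫ x in E, η x = ∫ z, k z * ∫ x in E, η x := by
    rw [integral_mul_const, hk1, one_mul]
  rw [h1, ← integral_sub (hkI.mul_const _) hinner]
  calc ∫ z, (k z * (∫ x in E, η x) - ∫ x in E, k z * η (x + r • z))
      ≤ ∫ z, k z * (r * (perimeter E).toReal) := by
        refine integral_mono ((hkI.mul_const _).sub hinner)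
          (hkI.mul_const _) fun z => ?_
        simp only [integral_const_mul, ← mul_sub]
        rcases le_or_gt 1 ‖z‖ with hz | hz
        · simp [hksupp z hz]
        · refine mul_le_mul_of_nonneg_left ?_ (hk0 z)
          refine (setIntegral_sub_translate_le_perimeter hvol hE hη hc hb (r • z)).trans ?_
          rw [norm_smul, Real.norm_of_nonneg hr]
          refine mul_le_mul_of_nonneg_right ?_ ENNReal.toReal_nonneg
          exact mul_le_of_le_one_right hr hz.le
    _ = r * (perimeter E).toReal := by rw [integral_mul_const, hk1, one_mul]

/-- The integrand is at most `K |a - b|` and vanishes off two unit balls, whence the factor 2. -/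
theorem integral_abs_translate_sub_translate_le {d : ℕ} {k : EuclideanSpace ℝ (Fin d) → ℝ}
    {K : ℝ≥0} (hk : Continuous k) (hkc : HasCompactSupport k)
    (hksupp : ∀ x, 1 ≤ ‖x‖ → k x = 0) (hK : LipschitzWith K k) (a b : EuclideanSpace ℝ (Fin d)) :
    ∫ y, |k (y - a) - k (y - b)| ≤
      2 * K * volume.real (Metric.ball (0 : EuclideanSpace ℝ (Fin d)) 1) * ‖a - b‖ := by
  have hI : ∀ c, Integrable ((Metric.ball c 1).indicator
      (1 : EuclideanSpace ℝ (Fin d) → ℝ)) := fun c =>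
    (integrable_indicator_iff measurableSet_ball).2 (integrableOn_const measure_ball_lt_top.ne)
  have hkI : Integrable k := hk.integrable_of_hasCompactSupport hkc
  have hball : ∀ c : EuclideanSpace ℝ (Fin d),
      volume.real (Metric.ball c 1) = volume.real (Metric.ball (0 : EuclideanSpace ℝ (Fin d)) 1) :=
    fun c => by simp only [Measure.real, Measure.addHaar_ball_center]
  calc ∫ y, |k (y - a) - k (y - b)|
      ≤ ∫ y, K * ‖a - b‖ * ((Metric.ball a 1).indicator (1 : EuclideanSpace ℝ (Fin d) → ℝ) y
          + (Metric.ball b 1).indicator (1 : EuclideanSpace ℝ (Fin d) → ℝ) y) := by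
        refine integral_mono ((hkI.comp_sub_right a).sub (hkI.comp_sub_right b)).abs
          (((hI a).add (hI b)).const_mul _) fun y => ?_
        have hlip : |k (y - a) - k (y - b)| ≤ K * ‖a - b‖ := by
          have := hK.dist_le_mul (y - a) (y - b)
          rwa [dist_sub_left, Real.dist_eq, dist_eq_norm] at this
        have h0 : 0 ≤ (K : ℝ) * ‖a - b‖ := by positivity
        by_cases ha : y ∈ Metric.ball a 1 <;> by_cases hb : y ∈ Metric.ball b 1
        · simp only [ha, hb, Set.indicator_of_mem, Pi.one_apply]; linarith
        · simpa [ha, hb] using hlip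
        · simpa [ha, hb] using hlip
        · rw [Metric.mem_ball, not_lt, dist_eq_norm] at ha hb
          simp only [hksupp _ ha, hksupp _ hb, sub_zero, abs_zero]
          exact mul_nonneg h0 (add_nonneg (Set.indicator_nonneg (fun _ _ => zero_le_one) _)
            (Set.indicator_nonneg (fun _ _ => zero_le_one) _))
    _ = _ := by
        rw [integral_const_mul, integral_add (hI a) (hI b),
          integral_indicator_one measurableSet_ball, integral_indicator_one measurableSet_ball,
          hball a, hball b]
        ring

/-- Substituting `w = z + x / r` moves the dependence on `x` from `η` to the kernel, so no
derivative of `η` enters the bound. -/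
theorem abs_average_sub_average_le {d : ℕ} {k : EuclideanSpace ℝ (Fin d) → ℝ}
    {K : ℝ≥0} (hk : Continuous k) (hkc : HasCompactSupport k)
    (hksupp : ∀ x, 1 ≤ ‖x‖ → k x = 0) (hK : LipschitzWith K k)
    {η : EuclideanSpace ℝ (Fin d) → ℝ} (hη : Continuous η) (hb : ∀ x, ‖η x‖ ≤ 1)
    {r : ℝ} (hr : 0 < r) (x y : EuclideanSpace ℝ (Fin d)) :
    |(∫ z, k z * η (x + r • z)) - ∫ z, k z * η (y + r • z)| ≤
      2 * K * volume.real (Metric.ball (0 : EuclideanSpace ℝ (Fin d)) 1) / r * ‖x - y‖ := by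
  have hkI : Integrable k := hk.integrable_of_hasCompactSupport hkc
  have hchange : ∀ x : EuclideanSpace ℝ (Fin d),
      ∫ z, k z * η (x + r • z) = ∫ w, k (w - r⁻¹ • x) * η (r • w) := by
    intro x
    rw [← integral_sub_right_eq_self (fun z => k z * η (x + r • z)) (r⁻¹ • x)]
    congr 1; ext w
    rw [smul_sub, smul_inv_smul₀ hr.ne', add_sub_cancel]
  have hI : ∀ a, Integrable fun w => k (w - a) * η (r • w) := fun a =>
    Integrable.mul_bdd (c := 1) (hkI.comp_sub_right a)
      (hη.comp (by fun_prop)).aestronglyMeasurable (ae_of_all _ fun p => hb _)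
  rw [hchange x, hchange y, ← integral_sub (hI _) (hI _)]
  calc |∫ w, (k (w - r⁻¹ • x) * η (r • w) - k (w - r⁻¹ • y) * η (r • w))|
      ≤ ∫ w, |k (w - r⁻¹ • x) * η (r • w) - k (w - r⁻¹ • y) * η (r • w)| :=
        abs_integral_le_integral_abs
    _ ≤ ∫ w, |k (w - r⁻¹ • x) - k (w - r⁻¹ • y)| := by
        refine integral_mono ((hI _).sub (hI _)).abs
          ((hkI.comp_sub_right _).sub (hkI.comp_sub_right _)).abs fun w => ?_
        simp only [← sub_mul, abs_mul]
        exact mul_le_of_le_one_right (abs_nonneg _) (hb _)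
    _ ≤ _ := integral_abs_translate_sub_translate_le hk hkc hksupp hK _ _
    _ = _ := by
        rw [← smul_sub, norm_smul, norm_inv, Real.norm_of_nonneg hr.le]
        ring

/-! ### Transport bound, degenerate case and choice of scale. -/

/-- The easy half of Kantorovich duality: integrate `f x - f y ≤ L * dist x y` against `γ`. -/
theorem integral_sub_integral_le_of_isTransportPlan {X : Type*} [MeasurableSpace X]
    [PseudoMetricSpace X] [OpensMeasurableSpace X] [SecondCountableTopology X]
    {μ ν : Measure X} [IsFiniteMeasure μ] {γ : Measure (X × X)}
    (hγ : IsTransportPlan μ ν γ) (hcost : ∫⁻ p, edist p.1 p.2 ∂γ < ∞)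
    {f : X → ℝ} {L : ℝ} (hL : ∀ x y, |f x - f y| ≤ L * dist x y)
    (hfm : Continuous f) {B : ℝ} (hfb : ∀ x, ‖f x‖ ≤ B) :
    (∫ x, f x ∂μ) - ∫ y, f y ∂ν ≤ L * (∫⁻ p, edist p.1 p.2 ∂γ).toReal := by
  obtain ⟨h1, h2⟩ := hγ
  have hfin : IsFiniteMeasure γ := by
    constructor
    have : γ Set.univ = μ Set.univ := by
      rw [← h1, Measure.map_apply measurable_fst MeasurableSet.univ, Set.preimage_univ]
    rw [this]
    exact measure_lt_top _ _
  have hm : AEMeasurable (fun p : X × X => edist p.1 p.2) γ :=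
    (continuous_fst.edist continuous_snd).measurable.aemeasurable
  have hI : Integrable (fun p : X × X => dist p.1 p.2) γ := by
    have := integrable_toReal_of_lintegral_ne_top hm hcost.ne
    simpa only [← dist_edist] using this
  have hI1 : Integrable (fun p : X × X => f p.1) γ :=
    Integrable.of_bound (hfm.comp continuous_fst).aestronglyMeasurable B
      (ae_of_all _ fun p => hfb _)
  have hI2 : Integrable (fun p : X × X => f p.2) γ :=
    Integrable.of_bound (hfm.comp continuous_snd).aestronglyMeasurable B
      (ae_of_all _ fun p => hfb _)
  rw [← h1, ← h2, integral_map measurable_fst.aemeasurable hfm.aestronglyMeasurable,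
    integral_map measurable_snd.aemeasurable hfm.aestronglyMeasurable, ← integral_sub hI1 hI2,
    ← integral_toReal hm (ae_lt_top' hm hcost.ne), ← integral_const_mul]
  simp only [← dist_edist]
  exact integral_mono (hI1.sub hI2) (hI.const_mul _) fun p => (le_abs_self _).trans (hL _ _)

/-- With zero perimeter, `∫_E η ≤ ∫_E η(x + n e)` for every `n`, and the right side tends to 0 as
the support of the translate escapes to infinity. Duality against `∅` then gives `|E| = 0`. A
nonzero `e` requires `d ≥ 1`; for `d = 0` a point has zero perimeter and volume 1. -/
theorem volume_eq_zero_of_perimeter_eq_zero {d : ℕ} (hd : 1 ≤ d)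
    {E : Set (EuclideanSpace ℝ (Fin d))} (hE : NullMeasurableSet E) (hvol : volume E < ∞)
    (hP : perimeter E = 0) : volume E = 0 := by
  have hfin : IsFiniteMeasure (volume.restrict E) := ⟨by simpa using hvol⟩
  have hreal : volume.real (E ∆ ∅) ≤ 0 := by
    refine volume_real_symmDiff_le_of_forall_integral_sub_le hE nullMeasurableSet_empty hvol
      (by simp) fun η hη hc hb => ?_
    simp only [Measure.restrict_empty, integral_zero_measure, sub_zero]
    have : Nonempty (Fin d) := ⟨⟨0, hd⟩⟩
    obtain ⟨e, he⟩ := exists_ne (0 : EuclideanSpace ℝ (Fin d))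
    have hlim : Filter.Tendsto (fun n : ℕ => ∫ x in E, η (x + n • e)) Filter.atTop
        (nhds (∫ x in E, (0 : ℝ))) := by
      refine tendsto_integral_of_dominated_convergence (fun _ => (1 : ℝ))
        (fun n => (hη.continuous.comp (by fun_prop)).aestronglyMeasurable)
        (integrable_const _) (fun n => ae_of_all _ fun x => hb _) (ae_of_all _ fun x => ?_)
      obtain ⟨R, hR⟩ := hc.isCompact.isBounded.subset_closedBall x
      refine tendsto_const_nhds.congr' ?_
      have hev : ∀ᶠ n : ℕ in Filter.atTop, R < n * ‖e‖ :=
        (tendsto_natCast_atTop_atTop.atTop_mul_const (norm_pos_iff.2 he)).eventually_gt_atTop R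
      filter_upwards [hev] with n hn
      refine (image_eq_zero_of_notMem_tsupport fun hx => ?_).symm
      have := hR hx
      rw [Metric.mem_closedBall, dist_eq_norm, add_sub_cancel_left, ← Nat.cast_smul_eq_nsmul ℝ,
        norm_smul, Real.norm_natCast] at this
      linarith
    rw [integral_zero] at hlim
    refine ge_of_tendsto' hlim fun n => ?_
    have := setIntegral_sub_translate_le_perimeter hvol (by simp [hP]) hη hc hb (n • e)
    simpa [hP] using this
  rw [← Set.bot_eq_empty, symmDiff_bot] at hreal
  exact (measureReal_eq_zero_iff hvol.ne).1 (le_antisymm hreal measureReal_nonneg)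

/-- The optimal scale `√w / √p` degenerates if `p` or `w` is 0, so both are shifted by `δ > 0` and
`δ → 0`. Taking `w' > w` allows for an infimum over plans that need not be attained. -/
theorem le_mul_sqrt_mul_sqrt_of_forall_le {v p w L : ℝ} (hp : 0 ≤ p) (hw : 0 ≤ w)
    (h : ∀ r > 0, ∀ w' > w, v ≤ r * p + L / r * w') : v ≤ (1 + L) * √p * √w := by
  have hlim : Filter.Tendsto (fun δ : ℝ => (1 + L) * √(p + δ) * √(w + δ)) (nhdsWithin 0 (Set.Ioi 0))
      (nhds ((1 + L) * √p * √w)) := by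
    have : Continuous fun δ : ℝ => (1 + L) * √(p + δ) * √(w + δ) := by fun_prop
    simpa using (this.tendsto 0).mono_left nhdsWithin_le_nhds
  refine ge_of_tendsto hlim ?_
  filter_upwards [self_mem_nhdsWithin] with δ (hδ : 0 < δ)
  have ha : 0 < √(p + δ) := Real.sqrt_pos.2 (by linarith)
  have hb : 0 < √(w + δ) := Real.sqrt_pos.2 (by linarith)
  have hr : 0 < √(w + δ) / √(p + δ) := div_pos hb ha
  calc v ≤ √(w + δ) / √(p + δ) * p + L / (√(w + δ) / √(p + δ)) * (w + δ) :=
        h _ hr _ (by linarith)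
    _ ≤ √(w + δ) / √(p + δ) * (p + δ) + L / (√(w + δ) / √(p + δ)) * (w + δ) := by
        gcongr
        linarith
    _ = √(w + δ) / √(p + δ) * √(p + δ) ^ 2 + L / (√(w + δ) / √(p + δ)) * √(w + δ) ^ 2 := by
        rw [Real.sq_sqrt (by linarith), Real.sq_sqrt (by linarith)]
    _ = (1 + L) * √(p + δ) * √(w + δ) := by field_simp

theorem exists_volume_real_symmDiff_le_of_isTransportPlan (d : ℕ) :
    ∃ L : ℝ≥0, ∀ E F : Set (EuclideanSpace ℝ (Fin d)),
      HasFinitePerimeter E → HasFinitePerimeter F → volume E < ∞ → volume F < ∞ →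
      ∀ γ, IsTransportPlan (volume.restrict E) (volume.restrict F) γ →
      ∫⁻ p, edist p.1 p.2 ∂γ < ∞ → ∀ r : ℝ, 0 < r →
      volume.real (E ∆ F) ≤ r * ((perimeter E).toReal + (perimeter F).toReal)
        + L / r * (∫⁻ p, edist p.1 p.2 ∂γ).toReal := by
  obtain ⟨k, K, hk, hkc, hk0, hksupp, hk1, hK⟩ := exists_unit_mass_lipschitz_kernel d
  refine ⟨2 * K * (volume.real (Metric.ball (0 : EuclideanSpace ℝ (Fin d)) 1)).toNNReal,
    fun E F hE hF hEv hFv γ hγ hcost r hr => ?_⟩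
  have hfin : IsFiniteMeasure (volume.restrict E) := ⟨by simpa using hEv⟩
  refine volume_real_symmDiff_le_of_forall_integral_sub_le hE.1 hF.1 hEv hFv
    fun η hη hc hb => ?_
  have h1 := setIntegral_sub_average_le_perimeter hEv hE.2 hk hkc hk0 hksupp hk1 hη hc hb hr.le
  -- On `F` the opposite inequality is needed, hence `-η`.
  have h2 := setIntegral_sub_average_le_perimeter hFv hF.2 hk hkc hk0 hksupp hk1 hη.neg
    (by exact hc.neg) (fun x => (norm_neg (η x)).trans_le (hb x)) hr.le
  simp only [mul_neg, integral_neg] at h2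
  have hL := abs_average_sub_average_le hk hkc hksupp hK hη.continuous hb hr
  have hkI : Integrable k := hk.integrable_of_hasCompactSupport hkc
  have hcont : Continuous fun x => ∫ z, k z * η (x + r • z) := by
    refine (LipschitzWith.of_dist_le' (K := 2 * K * volume.real
      (Metric.ball (0 : EuclideanSpace ℝ (Fin d)) 1) / r) fun x y => ?_).continuous
    rw [Real.dist_eq, dist_eq_norm]
    exact hL x y
  have hbdd : ∀ x, ‖∫ z, k z * η (x + r • z)‖ ≤ 1 := by
    intro x
    rw [← hk1]
    refine norm_integral_le_of_norm_le hkI (ae_of_all _ fun z => ?_)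
    rw [norm_mul, Real.norm_of_nonneg (hk0 z)]
    exact mul_le_of_le_one_right (hk0 z) (hb _)
  have h3 := integral_sub_integral_le_of_isTransportPlan hγ hcost
    (fun x y => by simpa only [dist_eq_norm] using hL x y) hcont hbdd
  push_cast
  rw [Real.coe_toNNReal _ measureReal_nonneg]
  linarith

theorem mainTheorem4 (d : ℕ) (hd : 1 ≤ d) :
    ∃ C : ℝ≥0, ∀ E F : Set (EuclideanSpace ℝ (Fin d)),
      HasFinitePerimeter E → HasFinitePerimeter F →
      ∫⁻ x in E ∪ F, ‖x‖ₑ ∂volume < ∞ →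
      volume (E ∆ F) ≤
        C * (perimeter E + perimeter F) ^ (1 / 2 : ℝ) *
          wassersteinOne (volume.restrict E) (volume.restrict F) ^ (1 / 2 : ℝ) := by
  obtain ⟨L, hL⟩ := exists_volume_real_symmDiff_le_of_isTransportPlan d
  refine ⟨1 + L, fun E F hE hF hmom => ?_⟩
  have hEFv := volume_lt_top_of_lintegral_enorm_lt_top hmom
  have hEv : volume E < ∞ := (measure_mono Set.subset_union_left).trans_lt hEFv
  have hFv : volume F < ∞ := (measure_mono Set.subset_union_right).trans_lt hEFv
  have hsd : volume (E ∆ F) ≠ ∞ :=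
    ((measure_mono Set.symmDiff_subset_union).trans_lt hEFv).ne
  set W := wassersteinOne (volume.restrict E) (volume.restrict F) with hW
  have hP : perimeter E + perimeter F ≠ ∞ := (ENNReal.add_lt_top.2 ⟨hE.2, hF.2⟩).ne
  rcases eq_or_ne W ∞ with hWtop | hWfin
  -- Since `0 * ∞ = 0`, the right side is infinite only when the total perimeter is nonzero.
  · rcases eq_or_ne (perimeter E + perimeter F) 0 with hP0 | hP0
    · have hE0 := volume_eq_zero_of_perimeter_eq_zero hd hE.1 hEv (add_eq_zero.1 hP0).1
      have hF0 := volume_eq_zero_of_perimeter_eq_zero hd hF.1 hFv (add_eq_zero.1 hP0).2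
      have : volume (E ∆ F) = 0 :=
        measure_mono_null Set.symmDiff_subset_union (measure_union_null hE0 hF0)
      rw [this]
      exact zero_le
    · rw [hWtop, ENNReal.top_rpow_of_pos (by norm_num), ENNReal.mul_top]
      · exact le_top
      · refine mul_ne_zero (by simp) ?_
        exact (ENNReal.rpow_pos (pos_iff_ne_zero.2 hP0) hP).ne'
  have hreal : volume.real (E ∆ F) ≤
      (1 + L) * √(perimeter E + perimeter F).toReal * √W.toReal := by
    refine le_mul_sqrt_mul_sqrt_of_forall_le ENNReal.toReal_nonneg ENNReal.toReal_nonneg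
      fun r hr w hw => ?_
    have hlt : W < ENNReal.ofReal w := (ENNReal.lt_ofReal_iff_toReal_lt hWfin).2 hw
    simp only [hW, wassersteinOne, iInf_lt_iff] at hlt
    obtain ⟨γ, hγ, hcost⟩ := hlt
    have hcost' := hcost.trans ENNReal.ofReal_lt_top
    refine (hL E F hE hF hEv hFv γ hγ hcost' r hr).trans ?_
    rw [ENNReal.toReal_add hE.2.ne hF.2.ne]
    gcongr
    exact ((ENNReal.lt_ofReal_iff_toReal_lt hcost'.ne).1 hcost).le
  rw [← ENNReal.ofReal_toReal hsd]
  refine (ENNReal.ofReal_le_ofReal hreal).trans_eq ?_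
  rw [ENNReal.ofReal_mul (by positivity), ENNReal.ofReal_mul (by positivity),
    Real.sqrt_eq_rpow, Real.sqrt_eq_rpow,
    ← ENNReal.ofReal_rpow_of_nonneg ENNReal.toReal_nonneg (by norm_num),
    ← ENNReal.ofReal_rpow_of_nonneg ENNReal.toReal_nonneg (by norm_num),
    ENNReal.ofReal_toReal hP, ENNReal.ofReal_toReal hWfin]
  congr 2
  rw [← NNReal.coe_one, ← NNReal.coe_add, ENNReal.ofReal_coe_nnreal]
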